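/- Let $\Gamma$ be a finite alphabet (containing the input letters and the chain-of-thought tokens). A relative positional encoding (RPE) is a set $\mathfrak R\subseteq\mathbb N\times\mathbb N$; the positions of a word $w=w_1\cdots w_N$ are $1,\dots,N$. *C-RASP.* Boolean-valued and count-valued C-RASP expressions, evaluated at a position $i$ of a word $w\in\Gamma^+$, are given by $$\varphi ::= Q_a\ (a\in\Gamma)\mid \top\mid\neg\varphi\mid\varphi\wedge\varphi\mid t\le t,\qquad t::= c\ (c\in\mathbb Z)\mid \overleftarrow{\#}[\varphi]\mid\overleftarrow{\#}_{\mathfrak R}[\varphi]\mid t+t\mid t-t\mid c\cdot t\mid(\varphi\,?\,t:t),$$ where $Q_a$ holds at $i$ iff $w_i=a$, $\overleftarrow{\#}[\varphi]$ is the number of $1\le j\le i$ such that $\varphi$ holds at $j$, and $\overleftarrow{\#}_{\mathfrak R}[\varphi]$ is the number of $1\le j\le i$ such that $(i,j)\in\mathfrak R$ and $\varphi$ holds at $j$. A CoT C-RASP program $P$ is a finite list of rules $O_{a_1}\leftarrow\varphi_1,\dots,O_{a_m}\leftarrow\varphi_m$ with $a_k\in\Gamma$. On $w$ it outputs $a_k$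 for the least $k$ such that $\varphi_k$ holds at position $|w|$, and nothing if there is no such $k$. *SMAT.* A CoT softmax averaging transformer $T$ reads $w$ preceded by a start-of-sequence symbol $\mathrm{SOS}$ at position $0$, a sequence of length $n=|w|+1$. It has a dimension $d$, a token embedding $\Gamma\cup\{\mathrm{SOS}\}\to\mathbb R^d$ (and no absolute positional encoding), finitely many layers, and an output matrix. A layer maps $\mathbf v_0,\dots,\mathbf v_{n-1}\in\mathbb R^d$ to $\mathbf w_i=\mathbf v_i+C(\mathbf v_i')$, where $\mathbf v_i'$ is the concatenation of the outputs of finitely many attention heads and $C$ is a feedforward network with one hidden layer, each hidden unit having ReLU or Heaviside activation. A head outputs $\sum_{j=0}^i\bar w(j)\mathbf v_j$ with $$\bar w=\mathrm{softmax}\bigl(\log n\cdot\{\mathbf v_j^T\mathbf K^T\mathbf Q\mathbf v_i+\lambda[\![\mathfrak R]\!](i,j)\}_{j=0}^i\bigr),$$ where the RPE term is optional, $\lambda\in\mathbb R$, and $[\![\mathfrak R]\!](i,j)$ is $1$ if $j\ge1$ and $(i,j)\in\mathfrak R$, and $0$ otherwise (so $\mathrm{SOS}$ receives no RPE bias). The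 output on $w$ is an argmax over $\Gamma\cup\{\mathrm{EOS}\}$ of a linear function of the final activation at the last position; the output $\mathrm{EOS}$ means that no token is output. *CoT.* Given $w\in\Gamma^+$ and a set $H\subseteq\Gamma$ of halting tokens, either device generates a finite or infinite sequence of tokens, its CoT: repeatedly, the token output on the current word is emitted and appended to the current word; this ends when no token is output or a token in $H$ has been emitted. **Proposition.** For every CoT C-RASP program $P$ over $\Gamma$ there is a CoT SMAT $T$ over $\Gamma$ such that every RPE used in $T$ occurs in $P$ (in particular, $T$ uses no RPEs if $P$ uses none), and such that for every $H\subseteq\Gamma$ and every $w\in\Gamma^+$ the CoT generated by $T$ on $w$ equals the CoT generated by $P$ on $w$. -/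

import Mathlib

namespace CoTCRASP

universe u

/-- Position `0` carries the start-of-sequence symbol (`none`); the letters of the word `w` occupy
the positions `1, …, |w|`. -/
def tokenAt {A : Type u} (w : List A) : ℕ → Option A
  | 0 => none
  | i + 1 => w[i]?

/-! ### C-RASP expressions -/

mutual

/-- Boolean-valued C-RASP expressions over the alphabet `A`. -/
inductive BoolExpr (A : Type u) : Type u
  | letter (a : A)
  | top
  | neg (φ : BoolExpr A)
  | and (φ ψ : BoolExpr A)
  | le (s t : CountExpr A)

/-- Count-valued C-RASP expressions: integer constants, the number of earlier-or-equal positions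
satisfying `φ`, the same restricted by an RPE `R`, linear combinations, and conditionals. -/
inductive CountExpr (A : Type u) : Type u
  | const (c : ℤ)
  | count (φ : BoolExpr A)
  | countRPE (R : Set (ℕ × ℕ)) (φ : BoolExpr A)
  | add (s t : CountExpr A)
  | sub (s t : CountExpr A)
  | smul (c : ℤ) (t : CountExpr A)
  | ite (φ : BoolExpr A) (s t : CountExpr A)

end

open Classical in
mutual

/-- Truth of a Boolean-valued expression at position `i` (with `1 ≤ i ≤ |w|`) of the word `w`. -/
noncomputable def BoolExpr.eval {A : Type u} (w : List A) : BoolExpr A → ℕ → Prop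
  | .letter a, i => tokenAt w i = some a
  | .top, _ => True
  | .neg φ, i => ¬ φ.eval w i
  | .and φ ψ, i => φ.eval w i ∧ ψ.eval w i
  | .le s t, i => s.eval w i ≤ t.eval w i

/-- Value of a count-valued expression at position `i` (with `1 ≤ i ≤ |w|`) of the word `w`. -/
noncomputable def CountExpr.eval {A : Type u} (w : List A) : CountExpr A → ℕ → ℤ
  | .const c, _ => c
  | .count φ, i => (((Finset.Icc 1 i).filter (fun j => φ.eval w j)).card : ℤ)
  | .countRPE R φ, i =>
      (((Finset.Icc 1 i).filter (fun j => (i, j) ∈ R ∧ φ.eval w j)).card : ℤ)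
  | .add s t, i => s.eval w i + t.eval w i
  | .sub s t, i => s.eval w i - t.eval w i
  | .smul c t, i => c * t.eval w i
  | .ite φ s t, i => if φ.eval w i then s.eval w i else t.eval w i

end

mutual

/-- The RPEs occurring in a Boolean-valued expression. -/
def BoolExpr.rpes {A : Type u} : BoolExpr A → Set (Set (ℕ × ℕ))
  | .letter _ => ∅
  | .top => ∅
  | .neg φ => φ.rpes
  | .and φ ψ => φ.rpes ∪ ψ.rpes
  | .le s t => s.rpes ∪ t.rpes

/-- The RPEs occurring in a count-valued expression. -/
def CountExpr.rpes {A : Type u} : CountExpr A → Set (Set (ℕ × ℕ))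
  | .const _ => ∅
  | .count φ => φ.rpes
  | .countRPE R φ => {R} ∪ φ.rpes
  | .add s t => s.rpes ∪ t.rpes
  | .sub s t => s.rpes ∪ t.rpes
  | .smul _ t => t.rpes
  | .ite φ s t => φ.rpes ∪ s.rpes ∪ t.rpes

end

/-! ### Chains of thought -/

open Classical in
/-- The chain of thought (a finite or infinite sequence of tokens) generated on input `w` by a
next-token function `next`. As long as `next` yields a token, it is emitted and appended to the
current word; generation ends when `next` yields none, or once a token in `halt` was emitted. -/
noncomputable def generate {A : Type u} (next : List A → Option A) (halt : Set A) (w : List A) :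
    Stream'.Seq A :=
  Stream'.Seq.corec
    (fun s : Option (List A) =>
      s.bind fun u => (next u).map fun a => (a, if a ∈ halt then none else some (u ++ [a])))
    (some w)

/-! ### CoT C-RASP programs -/

/-- A CoT C-RASP program: a switch `O_{a₁} ← φ₁; …; O_{aₘ} ← φₘ` of C-RASP expressions. -/
structure Program (A : Type u) where
  rules : List (A × BoolExpr A)

namespace Program

variable {A : Type u}

open Classical in
/-- The token of the first rule whose condition holds at the last position, if there is one. -/
noncomputable def next (P : Program A) (w : List A) : Option A :=
  (P.rules.find? (fun r => decide (r.2.eval w w.length))).map Prod.fst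

/-- The RPEs occurring in the program. -/
def rpes (P : Program A) : Set (Set (ℕ × ℕ)) :=
  {R | ∃ r ∈ P.rules, R ∈ r.2.rpes}

/-- The chain of thought computed by the program. -/
noncomputable def cot (P : Program A) (halt : Set A) (w : List A) : Stream'.Seq A :=
  generate P.next halt w

end Program

/-! ### Softmax averaging transformers -/

inductive Activation
  | relu
  | heaviside

noncomputable def Activation.eval : Activation → ℝ → ℝ
  | .relu, x => max x 0
  | .heaviside, x => if 0 < x then 1 else 0

/-- An attention head on `ℝ^d`: key and query matrices, and possibly an RPE together with its
bias coefficient `λ`. -/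
structure Head (d : ℕ) where
  K : Matrix (Fin d) (Fin d) ℝ
  Q : Matrix (Fin d) (Fin d) ℝ
  rpe : Option (Set (ℕ × ℕ) × ℝ)

open Classical in
/-- The RPE bias `λ·⟦R⟧(i,j)`. It relates positions of the word, hence vanishes on the
start-of-sequence symbol. -/
noncomputable def rpeBias (r : Option (Set (ℕ × ℕ) × ℝ)) (i j : ℕ) : ℝ :=
  match r with
  | none => 0
  | some (R, l) => l * (if 1 ≤ j ∧ (i, j) ∈ R then 1 else 0)

namespace Head

variable {d : ℕ}

/-- The (unscaled) attention logit of query position `i` for key position `j`. -/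
noncomputable def logit (h : Head d) (v : ℕ → Fin d → ℝ) (i j : ℕ) : ℝ :=
  dotProduct (h.K.mulVec (v j)) (h.Q.mulVec (v i)) + rpeBias h.rpe i j

/-- The attention weights `softmax (log n · {logit i j}_{j ≤ i})`; here `n` is the length of the
sequence that is processed. -/
noncomputable def weight (h : Head d) (n : ℕ) (v : ℕ → Fin d → ℝ) (i j : ℕ) : ℝ :=
  Real.exp (Real.log n * h.logit v i j) /
    ∑ k ∈ Finset.range (i + 1), Real.exp (Real.log n * h.logit v i k)

/-- The causally masked softmax average at position `i`. -/
noncomputable def attend (h : Head d) (n : ℕ) (v : ℕ → Fin d → ℝ) (i : ℕ) : Fin d → ℝ :=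
  ∑ j ∈ Finset.range (i + 1), h.weight n v i j • v j

end Head

/-- A layer: `numHeads` attention heads, and a feedforward network with one hidden layer of
`width` units, each with ReLU or Heaviside activation, that reads the outputs of all heads. -/
structure Layer (d : ℕ) where
  numHeads : ℕ
  heads : Fin numHeads → Head d
  width : ℕ
  act : Fin width → Activation
  W₁ : Matrix (Fin width) (Fin numHeads × Fin d) ℝ
  b₁ : Fin width → ℝ
  W₂ : Matrix (Fin d) (Fin width) ℝ
  b₂ : Fin d → ℝ

namespace Layer

variable {d : ℕ}

/-- The feedforward network `C`. -/
noncomputable def ffn (L : Layer d) (x : Fin L.numHeads × Fin d → ℝ) : Fin d → ℝ :=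
  L.W₂.mulVec (fun k => (L.act k).eval ((L.W₁.mulVec x + L.b₁) k)) + L.b₂

/-- One layer: `wᵢ = vᵢ + C(vᵢ')`, with `vᵢ'` the outputs of the attention heads at `i`. -/
noncomputable def apply (L : Layer d) (n : ℕ) (v : ℕ → Fin d → ℝ) (i : ℕ) : Fin d → ℝ :=
  v i + L.ffn (fun p => (L.heads p.1).attend n v i p.2)

end Layer

/-- A CoT SMAT over the alphabet `A`. The argument `none` of the embedding is the start-of-sequence
symbol; the row `none` of the output matrix is the end-of-sequence symbol. -/
structure SMAT (A : Type u) where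
  d : ℕ
  em : Option A → Fin d → ℝ
  layers : List (Layer d)
  out : Matrix (Option A) (Fin d) ℝ

namespace SMAT

variable {A : Type u}

/-- The activations after the last layer, on the start-of-sequence symbol followed by `w` (a
sequence of length `|w| + 1`). By causality position `i` depends on positions `≤ i` only. -/
noncomputable def activations (T : SMAT A) (w : List A) : ℕ → Fin T.d → ℝ :=
  T.layers.foldl (fun v L => L.apply (w.length + 1) v) (fun i => T.em (tokenAt w i))

/-- The output symbol read off at the last position: an argmax of the linear scores. The value
`none` is the end-of-sequence symbol. -/
noncomputable def next [Finite A] (T : SMAT A) (w : List A) : Option A :=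
  Classical.choose (Finite.exists_max (T.out.mulVec (T.activations w w.length)))

/-- The RPEs used by the attention heads. -/
def rpes (T : SMAT A) : Set (Set (ℕ × ℕ)) :=
  {R | ∃ L ∈ T.layers, ∃ h : Fin L.numHeads, ∃ l : ℝ, (L.heads h).rpe = some (R, l)}

/-- The chain of thought generated by the transformer. -/
noncomputable def cot [Finite A] (T : SMAT A) (halt : Set A) (w : List A) : Stream'.Seq A :=
  generate T.next halt w

end SMAT

end CoTCRASP

namespace CoTCRASP

universe u

-- The program is compiled into a circuit of threshold gates over counts, and each gate becomes one
-- layer with a single Heaviside unit writing to a fresh coordinate.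
--
-- On the logical side, conditionals are pulled out of count terms, so every comparison reduces to
-- Boolean combinations of `0 ≤ f` with `f` an integer combination of counts. Since `0 ≤ f` iff `0 <
-- 1 + 2 * f`, and `1 + 2 * f` is odd, only signs of nonvanishing integers are needed. This is the
-- class `Definable` (`BoolExpr.exists_definable`, `Program.exists_definable_next`).
--
-- On the transformer side, the factor `log n` turns attention weights into powers of `n`. If SOS
-- outweighs every selected position by `n ^ M`, and unselected positions are negligible, the
-- average of a feature is its count divided by `n ^ M`, up to a small relative error
-- (`countHead_attend`). An integer combination that does not vanish keeps its sign under errors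
-- below 1, and the unknown positive factor `n ^ M` does not affect the sign (`Realizes.pos`). The
-- feedforward network sees only head outputs, so the truth value at the query position itself is
-- recovered by attending to the positions that agree with it (`agreeHead_attend`); this gives
-- Boolean gates (`Realizes.nand`).
--
-- Finally, the output matrix compares one coordinate per token with the constant `1 / 2`.

/-- Predicates on the positions of words. -/
abbrev Feature (A : Type u) := List A → ℕ → Prop

open Classical in
/-- The number of positions `1 ≤ j ≤ i` with `p` that are related to `i` by the RPE, if any. -/
noncomputable def selCount {A : Type u} (R : Option (Set (ℕ × ℕ))) (p : Feature A) (w : List A)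
    (i : ℕ) : ℕ :=
  ((Finset.Icc 1 i).filter (fun j => (∀ S ∈ R, (i, j) ∈ S) ∧ p w j)).card

/-- A term of an integer combination of counts: coefficient, optional RPE, counted feature. -/
abbrev CountTerm (A : Type u) := ℤ × Option (Set (ℕ × ℕ)) × Feature A

noncomputable def linSum {A : Type u} (L : List (CountTerm A)) (w : List A) (i : ℕ) : ℤ :=
  (L.map fun t => t.1 * (selCount t.2.1 t.2.2 w i : ℤ)).sum

/-- The features obtained from letters and the first position by `nand` and by the sign of integer
combinations of counts that never vanish on the word. -/
inductive Definable {A : Type u} (𝓡 : Set (Set (ℕ × ℕ))) : Feature A → Prop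
  | letter (a : A) : Definable 𝓡 (fun w i => tokenAt w i = some a)
  | first : Definable 𝓡 (fun _ i => i = 1)
  | nand {p q : Feature A} (hp : Definable 𝓡 p) (hq : Definable 𝓡 q) :
      Definable 𝓡 (fun w i => i ≠ 0 ∧ ¬(p w i ∧ q w i))
  | pos {L : List (CountTerm A)} (hR : ∀ t ∈ L, ∀ S ∈ t.2.1, S ∈ 𝓡)
      (hL : ∀ t ∈ L, Definable 𝓡 t.2.2) (hne : ∀ w i, i ≠ 0 → linSum L w i ≠ 0) :
      Definable 𝓡 (fun w i => 0 < linSum L w i)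

-- Counts, and Boolean closure of definable features

section

variable {A : Type u} {𝓡 : Set (Set (ℕ × ℕ))}

open Classical in
theorem selCount_none (p : Feature A) (w : List A) (i : ℕ) :
    selCount none p w i = ((Finset.Icc 1 i).filter (fun j => p w j)).card := by
  refine congrArg Finset.card (Finset.filter_congr fun j _ => ?_)
  simp

open Classical in
theorem selCount_some (R : Set (ℕ × ℕ)) (p : Feature A) (w : List A) (i : ℕ) :
    selCount (some R) p w i =
      ((Finset.Icc 1 i).filter (fun j => (i, j) ∈ R ∧ p w j)).card := by
  refine congrArg Finset.card (Finset.filter_congr fun j _ => ?_)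
  simp

theorem selCount_zero (R : Option (Set (ℕ × ℕ))) (p : Feature A) (w : List A) :
    selCount R p w 0 = 0 := by
  simp [selCount]

theorem linSum_zero (L : List (CountTerm A)) (w : List A) : linSum L w 0 = 0 := by
  simp [linSum, selCount_zero]

theorem linSum_cons (t : CountTerm A) (L : List (CountTerm A)) (w : List A) (i : ℕ) :
    linSum (t :: L) w i = t.1 * (selCount t.2.1 t.2.2 w i : ℤ) + linSum L w i := by
  simp [linSum]

theorem linSum_append (L L' : List (CountTerm A)) (w : List A) (i : ℕ) :
    linSum (L ++ L') w i = linSum L w i + linSum L' w i := by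
  simp [linSum]

theorem linSum_scale (c : ℤ) (L : List (CountTerm A)) (w : List A) (i : ℕ) :
    linSum (L.map fun t => (c * t.1, t.2)) w i = c * linSum L w i := by
  induction L with
  | nil => simp [linSum]
  | cons t L ih => rw [List.map_cons, linSum_cons, linSum_cons, ih]; ring

theorem selCount_congr {R : Option (Set (ℕ × ℕ))} {p q : Feature A} {w : List A}
    (h : ∀ i, i ≠ 0 → (p w i ↔ q w i)) (i : ℕ) : selCount R p w i = selCount R q w i := by
  classical
  refine congrArg Finset.card (Finset.filter_congr fun j hj => ?_)
  rw [h j (by have := Finset.mem_Icc.1 hj; omega)]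

/-- Supplies integer constants: `c` is written as `c` times this count. -/
theorem selCount_first {i : ℕ} (hi : i ≠ 0) (w : List A) :
    selCount none (fun _ i => i = 1) w i = 1 := by
  rw [selCount, Finset.card_eq_one]
  refine ⟨1, ?_⟩
  ext j
  simp only [Finset.mem_filter, Finset.mem_Icc, Finset.mem_singleton]
  constructor
  · exact fun h => h.2.2
  · rintro rfl
    exact ⟨by omega, by simp, rfl⟩

namespace Definable

/-- Needed for counting by attention: SOS carries most of the weight, so it must add nothing to the
numerator. -/
theorem not_zero {p : Feature A} (hp : Definable 𝓡 p) (w : List A) : ¬ p w 0 := by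
  cases hp with
  | letter a => simp [tokenAt]
  | first => simp
  | nand => simp
  | pos => simp [linSum_zero]

theorem congr {p q : Feature A} (hp : Definable 𝓡 p) (h : ∀ w i, p w i ↔ q w i) :
    Definable 𝓡 q := by
  have : p = q := by
    funext w i
    exact propext (h w i)
  exact this ▸ hp

theorem neg {p : Feature A} (hp : Definable 𝓡 p) : Definable 𝓡 (fun w i => i ≠ 0 ∧ ¬ p w i) :=
  (nand hp hp).congr fun w i => by simp

theorem and {p q : Feature A} (hp : Definable 𝓡 p) (hq : Definable 𝓡 q) :
    Definable 𝓡 (fun w i => p w i ∧ q w i) :=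
  (nand hp hq).neg.congr fun w i => by
    by_cases hi : i = 0
    · subst hi
      simp [hp.not_zero w]
    · simp only [ne_eq, hi, not_false_eq_true, true_and, not_not]

theorem or {p q : Feature A} (hp : Definable 𝓡 p) (hq : Definable 𝓡 q) :
    Definable 𝓡 (fun w i => p w i ∨ q w i) :=
  (nand hp.neg hq.neg).congr fun w i => by
    by_cases hi : i = 0
    · subst hi
      simp [hp.not_zero w, hq.not_zero w]
    · simp only [ne_eq, hi, not_false_eq_true, true_and]
      tauto

theorem falsum : Definable (A := A) 𝓡 (fun _ _ => False) :=
  (first.and first.neg).congr fun w i => by tauto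

theorem verum : Definable (A := A) 𝓡 (fun _ i => i ≠ 0) :=
  (falsum.neg).congr fun w i => by simp

end Definable

-- Count-valued functions with conditionals pulled outside

open Classical in
/-- Count-valued functions obtained from integer combinations of counts by case distinctions. -/
inductive PiecewiseLinear (𝓡 : Set (Set (ℕ × ℕ))) : (List A → ℕ → ℤ) → Prop
  | lin {L : List (CountTerm A)} (hR : ∀ t ∈ L, ∀ S ∈ t.2.1, S ∈ 𝓡)
      (hL : ∀ t ∈ L, Definable 𝓡 t.2.2) : PiecewiseLinear 𝓡 (linSum L)
  | ite {p : Feature A} {f g : List A → ℕ → ℤ} (hp : Definable 𝓡 p) (hf : PiecewiseLinear 𝓡 f)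
      (hg : PiecewiseLinear 𝓡 g) : PiecewiseLinear 𝓡 (fun w i => if p w i then f w i else g w i)

namespace PiecewiseLinear

theorem congr {f g : List A → ℕ → ℤ} (hf : PiecewiseLinear 𝓡 f) (h : ∀ w i, f w i = g w i) :
    PiecewiseLinear 𝓡 g := by
  have : f = g := by
    funext w i
    exact h w i
  exact this ▸ hf

theorem singleton (c : ℤ) {R : Option (Set (ℕ × ℕ))} (hR : ∀ S ∈ R, S ∈ 𝓡) {p : Feature A}
    (hp : Definable 𝓡 p) : PiecewiseLinear 𝓡 (fun w i => c * (selCount R p w i : ℤ)) :=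
  (lin (L := [(c, R, p)]) (by simpa using hR) (by simpa using hp)).congr fun w i => by
    simp [linSum]

theorem smul (c : ℤ) {f : List A → ℕ → ℤ} (hf : PiecewiseLinear 𝓡 f) :
    PiecewiseLinear 𝓡 (fun w i => c * f w i) := by
  induction hf with
  | @lin L hR hL =>
    refine (lin (L := L.map fun t => (c * t.1, t.2)) ?_ ?_).congr (linSum_scale c L)
    · intro t ht
      obtain ⟨s, hs, rfl⟩ := List.mem_map.1 ht
      exact hR s hs
    · intro t ht
      obtain ⟨s, hs, rfl⟩ := List.mem_map.1 ht
      exact hL s hs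
  | ite hp _ _ ihf ihg => exact (ite hp ihf ihg).congr fun w i => by dsimp only; split_ifs <;> rfl

theorem add {f g : List A → ℕ → ℤ} (hf : PiecewiseLinear 𝓡 f) (hg : PiecewiseLinear 𝓡 g) :
    PiecewiseLinear 𝓡 (fun w i => f w i + g w i) := by
  induction hf with
  | @lin L hR hL =>
    induction hg with
    | @lin L' hR' hL' =>
      refine (lin (L := L ++ L') ?_ ?_).congr (linSum_append L L')
      · intro t ht
        exact (List.mem_append.1 ht).elim (hR t) (hR' t)
      · intro t ht
        exact (List.mem_append.1 ht).elim (hL t) (hL' t)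
    | ite hp _ _ ihf ihg => exact (ite hp ihf ihg).congr fun w i => by dsimp only; split_ifs <;> rfl
  | ite hp _ _ ihf ihg => exact (ite hp ihf ihg).congr fun w i => by dsimp only; split_ifs <;> rfl

/-- On a linear piece, `0 ≤ f` iff `0 < 1 + 2 * f`, and the right-hand side is odd, hence never zero
as `Definable.pos` requires. A conditional becomes a disjunction over its two cases. -/
theorem definable_nonneg {f : List A → ℕ → ℤ} (hf : PiecewiseLinear 𝓡 f) :
    Definable 𝓡 (fun w i => i ≠ 0 ∧ 0 ≤ f w i) := by
  induction hf with
  | @lin L hR hL =>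
    have key : ∀ w i, i ≠ 0 →
        linSum ((1, none, fun _ i => i = 1) :: L.map fun t => (2 * t.1, t.2)) w i =
          1 + 2 * linSum L w i := by
      intro w i hi
      rw [linSum_cons, linSum_scale, selCount_first hi]
      simp
    refine (Definable.pos (L := (1, none, fun _ i => i = 1) :: L.map fun t => (2 * t.1, t.2))
      ?_ ?_ ?_).congr ?_
    · intro t ht
      rcases List.mem_cons.1 ht with rfl | ht
      · simp
      · obtain ⟨s, hs, rfl⟩ := List.mem_map.1 ht
        exact hR s hs
    · intro t ht
      rcases List.mem_cons.1 ht with rfl | ht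
      · exact Definable.first
      · obtain ⟨s, hs, rfl⟩ := List.mem_map.1 ht
        exact hL s hs
    · intro w i hi
      rw [key w i hi]
      omega
    · intro w i
      by_cases hi : i = 0
      · subst hi
        simp [linSum_zero]
      · rw [key w i hi]
        omega
  | @ite p f g hp _ _ ihf ihg =>
    refine ((hp.and ihf).or (hp.neg.and ihg)).congr fun w i => ?_
    by_cases h : p w i <;> simp [h]

end PiecewiseLinear

-- Translation of C-RASP expressions and programs

mutual

theorem BoolExpr.exists_definable : ∀ φ : BoolExpr A, φ.rpes ⊆ 𝓡 →
    ∃ p : Feature A, Definable 𝓡 p ∧ ∀ w i, i ≠ 0 → (p w i ↔ φ.eval w i)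
  | .letter a, _ => ⟨_, .letter a, fun w i _ => by simp [BoolExpr.eval]⟩
  | .top, _ => ⟨_, .verum, fun w i hi => by simp [BoolExpr.eval, hi]⟩
  | .neg φ, h => by
    obtain ⟨p, hp, hpe⟩ := BoolExpr.exists_definable φ (by simpa [BoolExpr.rpes] using h)
    exact ⟨_, hp.neg, fun w i hi => by simp [BoolExpr.eval, hi, hpe w i hi]⟩
  | .and φ ψ, h => by
    simp only [BoolExpr.rpes, Set.union_subset_iff] at h
    obtain ⟨p, hp, hpe⟩ := BoolExpr.exists_definable φ h.1
    obtain ⟨q, hq, hqe⟩ := BoolExpr.exists_definable ψ h.2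
    exact ⟨_, hp.and hq, fun w i hi => by simp [BoolExpr.eval, hpe w i hi, hqe w i hi]⟩
  | .le s t, h => by
    simp only [BoolExpr.rpes, Set.union_subset_iff] at h
    obtain ⟨f, hf, hfe⟩ := CountExpr.exists_piecewiseLinear s h.1
    obtain ⟨g, hg, hge⟩ := CountExpr.exists_piecewiseLinear t h.2
    refine ⟨_, (hg.add (hf.smul (-1))).definable_nonneg, fun w i hi => ?_⟩
    simp only [BoolExpr.eval, hfe w i hi, hge w i hi]
    omega

theorem CountExpr.exists_piecewiseLinear : ∀ t : CountExpr A, t.rpes ⊆ 𝓡 →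
    ∃ f : List A → ℕ → ℤ, PiecewiseLinear 𝓡 f ∧ ∀ w i, i ≠ 0 → f w i = t.eval w i
  | .const c, _ =>
    ⟨_, .singleton c (R := none) (by simp) .first, fun w i hi => by
      simp [CountExpr.eval, selCount_first hi]⟩
  | .count φ, h => by
    obtain ⟨p, hp, hpe⟩ := BoolExpr.exists_definable φ (by simpa [CountExpr.rpes] using h)
    refine ⟨_, .singleton 1 (R := none) (by simp) hp, fun w i _ => ?_⟩
    rw [selCount_congr (q := fun w i => φ.eval w i) (hpe w)]
    simp only [CountExpr.eval, one_mul, selCount_none]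
  | .countRPE R φ, h => by
    simp only [CountExpr.rpes, Set.union_subset_iff, Set.singleton_subset_iff] at h
    obtain ⟨p, hp, hpe⟩ := BoolExpr.exists_definable φ h.2
    refine ⟨_, .singleton 1 (R := some R) (by simpa using h.1) hp, fun w i _ => ?_⟩
    rw [selCount_congr (q := fun w i => φ.eval w i) (hpe w)]
    simp only [CountExpr.eval, one_mul, selCount_some]
  | .add s t, h => by
    simp only [CountExpr.rpes, Set.union_subset_iff] at h
    obtain ⟨f, hf, hfe⟩ := CountExpr.exists_piecewiseLinear s h.1
    obtain ⟨g, hg, hge⟩ := CountExpr.exists_piecewiseLinear t h.2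
    exact ⟨_, hf.add hg, fun w i hi => by simp [CountExpr.eval, hfe w i hi, hge w i hi]⟩
  | .sub s t, h => by
    simp only [CountExpr.rpes, Set.union_subset_iff] at h
    obtain ⟨f, hf, hfe⟩ := CountExpr.exists_piecewiseLinear s h.1
    obtain ⟨g, hg, hge⟩ := CountExpr.exists_piecewiseLinear t h.2
    refine ⟨_, hf.add (hg.smul (-1)), fun w i hi => ?_⟩
    simp only [CountExpr.eval, hfe w i hi, hge w i hi]
    ring
  | .smul c t, h => by
    obtain ⟨f, hf, hfe⟩ := CountExpr.exists_piecewiseLinear t (by simpa [CountExpr.rpes] using h)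
    exact ⟨_, hf.smul c, fun w i hi => by simp [CountExpr.eval, hfe w i hi]⟩
  | .ite φ s t, h => by
    simp only [CountExpr.rpes, Set.union_subset_iff] at h
    obtain ⟨p, hp, hpe⟩ := BoolExpr.exists_definable φ h.1.1
    obtain ⟨f, hf, hfe⟩ := CountExpr.exists_piecewiseLinear s h.1.2
    obtain ⟨g, hg, hge⟩ := CountExpr.exists_piecewiseLinear t h.2
    refine ⟨_, .ite hp hf hg, fun w i hi => ?_⟩
    by_cases h' : φ.eval w i <;> simp [CountExpr.eval, hfe w i hi, hge w i hi, hpe w i hi, h']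

end

/-- For each token, "the program outputs this token" is definable. -/
theorem Program.exists_definable_next (P : Program A) (a : A) :
    ∃ p : Feature A, Definable P.rpes p ∧ ∀ w, w ≠ [] → (p w w.length ↔ P.next w = some a) := by
  obtain ⟨rules⟩ := P
  suffices H : ∀ rs : List (A × BoolExpr A), (∀ r ∈ rs, r ∈ rules) →
      ∃ p : Feature A, Definable (Program.rpes ⟨rules⟩) p ∧
        ∀ w, w ≠ [] → (p w w.length ↔ Program.next ⟨rs⟩ w = some a) from H rules fun _ h => h
  intro rs
  induction rs with
  | nil => exact fun _ => ⟨_, .falsum, fun w _ => by simp [Program.next]⟩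
  | cons r rs ih =>
    intro hrs
    obtain ⟨p, hp, hpe⟩ := ih fun s hs => hrs s (List.mem_cons_of_mem _ hs)
    obtain ⟨q, hq, hqe⟩ := BoolExpr.exists_definable (𝓡 := Program.rpes ⟨rules⟩) r.2
      fun R hR => ⟨r, hrs r List.mem_cons_self, hR⟩
    have hlen : ∀ w : List A, w ≠ [] → w.length ≠ 0 := fun w hw => by simpa using hw
    -- The first matching rule wins: a leading rule for `a` contributes `q ∨ p`, a leading rule for
    -- another token must fail, giving `¬ q ∧ p`.
    by_cases ha : r.1 = a
    · refine ⟨_, hq.or hp, fun w hw => ?_⟩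
      rw [hqe w _ (hlen w hw), hpe w hw]
      by_cases h : r.2.eval w w.length <;> simp [Program.next, h, ha]
    · refine ⟨_, hq.neg.and hp, fun w hw => ?_⟩
      rw [hqe w _ (hlen w hw), hpe w hw]
      by_cases h : r.2.eval w w.length <;> simp [Program.next, h, ha, hw]

end

open Classical in
noncomputable def bit (p : Prop) : ℝ := if p then 1 else 0

theorem bit_true {p : Prop} (h : p) : bit p = 1 := if_pos h

theorem bit_false {p : Prop} (h : ¬ p) : bit p = 0 := if_neg h

/-! ### Heads and their attention -/

section Heads

variable {d : ℕ}

/-- A head whose logits are products of a linear form at the key and one at the query. -/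
noncomputable def bilinearHead (o : Fin d) (α β : Fin d → ℝ) (r : Option (Set (ℕ × ℕ) × ℝ)) :
    Head d where
  K := Matrix.vecMulVec (Pi.single o 1) α
  Q := Matrix.vecMulVec (Pi.single o 1) β
  rpe := r

theorem bilinearHead_logit (o : Fin d) (α β : Fin d → ℝ) (r : Option (Set (ℕ × ℕ) × ℝ))
    (v : ℕ → Fin d → ℝ) (i j : ℕ) :
    (bilinearHead o α β r).logit v i j =
      dotProduct α (v j) * dotProduct β (v i) + rpeBias r i j := by
  simp only [Head.logit, bilinearHead, Matrix.vecMulVec_mulVec, smul_dotProduct, dotProduct_smul,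
    single_dotProduct, Pi.single_eq_same, MulOpposite.smul_eq_mul_unop, MulOpposite.unop_op]
  ring

theorem Head.attend_apply (h : Head d) (n : ℕ) (v : ℕ → Fin d → ℝ) (i : ℕ) (c : Fin d) :
    h.attend n v i c =
      (∑ j ∈ Finset.range (i + 1), Real.exp (Real.log n * h.logit v i j) * v j c) /
        ∑ k ∈ Finset.range (i + 1), Real.exp (Real.log n * h.logit v i k) := by
  simp only [Head.attend, Finset.sum_apply, Pi.smul_apply, smul_eq_mul, Head.weight]
  rw [Finset.sum_div]
  exact Finset.sum_congr rfl fun j _ => by ring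

/-- If the query position has large weight and the positions with a different value have small
weight, then the weighted average is close to the value at the query position. -/
theorem abs_weighted_avg_sub_le {e x : ℕ → ℝ} {i : ℕ} {ε : ℝ} (he : ∀ j, 0 < e j)
    (h : ∀ j ≤ i, e j * |x j - x i| ≤ ε * e i) (hε : 0 ≤ ε) :
    |(∑ j ∈ Finset.range (i + 1), e j * x j) / (∑ j ∈ Finset.range (i + 1), e j) - x i| ≤
      (i + 1) * ε := by
  have hle : e i ≤ ∑ j ∈ Finset.range (i + 1), e j :=
    Finset.single_le_sum (f := e) (fun j _ => (he j).le) (Finset.self_mem_range_succ i)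
  have hpos := (he i).trans_le hle
  have hrw : (∑ j ∈ Finset.range (i + 1), e j * x j) / (∑ j ∈ Finset.range (i + 1), e j) - x i =
      (∑ j ∈ Finset.range (i + 1), e j * (x j - x i)) / ∑ j ∈ Finset.range (i + 1), e j := by
    simp only [mul_sub, Finset.sum_sub_distrib, ← Finset.sum_mul]
    field_simp
  rw [hrw, abs_div, abs_of_pos hpos, div_le_iff₀ hpos]
  calc |∑ j ∈ Finset.range (i + 1), e j * (x j - x i)|
      ≤ ∑ j ∈ Finset.range (i + 1), |e j * (x j - x i)| := Finset.abs_sum_le_sum_abs _ _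
    _ ≤ ∑ _j ∈ Finset.range (i + 1), ε * e i := by
        refine Finset.sum_le_sum fun j hj => ?_
        rw [abs_mul, abs_of_pos (he j)]
        exact h j (by have := Finset.mem_range.1 hj; omega)
    _ = (i + 1) * ε * e i := by simp; ring
    _ ≤ _ := by gcongr

/-- Attention to the positions that agree with the query position in coordinate `a`; the
coordinate `one` is assumed to be constantly `1`. -/
noncomputable def agreeHead (one a : Fin d) : Head d :=
  bilinearHead one ((8 : ℝ) • Pi.single a 1 - (4 : ℝ) • Pi.single one 1)
    ((2 : ℝ) • Pi.single a 1 - Pi.single one 1) none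

/-- The logit is `4` where the bits agree and `-4` where they differ, so a disagreeing position has
relative weight `n ^ (-8)`. At most `n` of them cause an error of at most `n ^ (-7) ≤ 1 / 128`. -/
theorem agreeHead_attend {one a : Fin d} {v : ℕ → Fin d → ℝ} {n i : ℕ} (hn : 2 ≤ n) (hi : i < n)
    {p : ℕ → Prop} (hone : ∀ j ≤ i, v j one = 1) (ha : ∀ j ≤ i, v j a = bit (p j)) :
    |(agreeHead one a).attend n v i a - bit (p i)| ≤ 1 / 16 := by
  have hn0 : (0 : ℝ) < n := by positivity
  have hlog : ∀ j ≤ i, (agreeHead one a).logit v i j =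
      4 * ((2 * bit (p j) - 1) * (2 * bit (p i) - 1)) := by
    intro j hj
    rw [agreeHead, bilinearHead_logit]
    simp only [sub_dotProduct, smul_dotProduct, single_dotProduct, one_mul, hone j hj,
      hone i le_rfl, ha j hj, ha i le_rfl, rpeBias, smul_eq_mul]
    ring
  rw [Head.attend_apply, ← ha i le_rfl]
  refine (abs_weighted_avg_sub_le (ε := ((n : ℝ) ^ 8)⁻¹) (x := fun j => v j a)
    (fun j => Real.exp_pos _) ?_ (by positivity)).trans ?_
  · intro j hj
    have hsmall : Real.exp (-(Real.log n * 4)) = ((n : ℝ) ^ 8)⁻¹ * Real.exp (Real.log n * 4) := by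
      have h8 : (n : ℝ) ^ 8 = Real.exp (Real.log n * 8) := by
        conv_lhs => rw [← Real.exp_log hn0, ← Real.exp_nat_mul]
        rw [mul_comm]; norm_num
      rw [h8, ← Real.exp_neg, ← Real.exp_add]
      congr 1; ring
    rw [hlog j hj, hlog i le_rfl, ha j hj, ha i le_rfl]
    by_cases h1 : p j <;> by_cases h2 : p i <;>
      simp only [bit_true, bit_false, h1, h2, not_false_eq_true] <;> norm_num
    · positivity
    · exact hsmall.le
    · exact hsmall.le
    · positivity
  · have h1 : (i + 1 : ℝ) ≤ n := by exact_mod_cast hi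
    have h2 : (2 : ℝ) ≤ n := by exact_mod_cast hn
    have h7 : (2 : ℝ) ^ 7 ≤ (n : ℝ) ^ 7 := by gcongr
    calc (i + 1 : ℝ) * ((n : ℝ) ^ 8)⁻¹ ≤ n * ((n : ℝ) ^ 8)⁻¹ := by gcongr
      _ = ((n : ℝ) ^ 7)⁻¹ := by field_simp
      _ ≤ ((2 : ℝ) ^ 7)⁻¹ := by gcongr
      _ ≤ 1 / 16 := by norm_num

theorem sum_range_succ_eq_add_sum_Icc (f : ℕ → ℝ) (i : ℕ) :
    ∑ j ∈ Finset.range (i + 1), f j = f 0 + ∑ j ∈ Finset.Icc 1 i, f j := by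
  have : Finset.range (i + 1) = insert 0 (Finset.Icc 1 i) := by
    ext j
    simp only [Finset.mem_range, Finset.mem_insert, Finset.mem_Icc]
    omega
  rw [this, Finset.sum_insert (by simp)]

/-- If position `0` has weight `B * s`, selected positions weight `B` and the other ones at most
`B * η`, then the weighted average of a feature is about the number of selected positions with
that feature, divided by `s`. -/
theorem abs_weighted_avg_mul_sub_card_le {e : ℕ → ℝ} {sel p : ℕ → Prop} [DecidablePred fun j => sel j ∧ p j]
    {i : ℕ} {n B s η δ : ℝ}
    (hB : 0 < B) (hs : 0 < s) (hη : 0 ≤ η) (hη1 : η ≤ 1) (hn : (i : ℝ) ≤ n) (hnη : n * η ≤ δ)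
    (hns : n ^ 2 ≤ δ * s) (he0 : e 0 = B * s) (hsel : ∀ j ∈ Finset.Icc 1 i, sel j → e j = B)
    (hnsel : ∀ j ∈ Finset.Icc 1 i, ¬ sel j → 0 ≤ e j ∧ e j ≤ B * η) (hp : ¬ p 0) :
    |(∑ j ∈ Finset.range (i + 1), e j * bit (p j)) / (∑ j ∈ Finset.range (i + 1), e j) * s -
      ((Finset.Icc 1 i).filter (fun j => sel j ∧ p j)).card| ≤ δ := by
  have hn0 : 0 ≤ n := (Nat.cast_nonneg i).trans hn
  have hδ : 0 ≤ δ := (mul_nonneg hn0 hη).trans hnη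
  set c : ℝ := (((Finset.Icc 1 i).filter (fun j => sel j ∧ p j)).card : ℝ) with hc
  have hcsum : c = ∑ j ∈ Finset.Icc 1 i, bit (sel j ∧ p j) := by
    rw [hc, Finset.card_filter]
    push_cast
    exact Finset.sum_congr rfl fun j _ => by unfold bit; congr
  have hcn : c ≤ n := by
    refine le_trans ?_ hn
    rw [hc]
    exact_mod_cast (Finset.card_filter_le _ _).trans (by simp)
  have hc0 : 0 ≤ c := Nat.cast_nonneg _
  rw [sum_range_succ_eq_add_sum_Icc, sum_range_succ_eq_add_sum_Icc, bit_false hp, mul_zero,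
    zero_add, he0]
  set N := ∑ j ∈ Finset.Icc 1 i, e j * bit (p j)
  set D := ∑ j ∈ Finset.Icc 1 i, e j
  have hN1 : B * c ≤ N := by
    rw [hcsum, Finset.mul_sum]
    refine Finset.sum_le_sum fun j hj => ?_
    by_cases h1 : sel j <;> by_cases h2 : p j <;> simp [bit, h1, h2]
    · exact (hsel j hj h1).ge
    · exact (hnsel j hj h1).1
  -- Each unselected position adds at most `B * η`, and there are at most `n` of them.
  have hN2 : N ≤ B * (c + δ) := by
    have : N ≤ ∑ j ∈ Finset.Icc 1 i, B * (bit (sel j ∧ p j) + η) := by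
      refine Finset.sum_le_sum fun j hj => ?_
      have := mul_nonneg hB.le hη
      by_cases h1 : sel j <;> by_cases h2 : p j <;> simp [bit, h1, h2]
      · rw [hsel j hj h1]; nlinarith
      · positivity
      · exact (hnsel j hj h1).2
      · positivity
    refine this.trans ?_
    rw [← Finset.mul_sum, Finset.sum_add_distrib, ← hcsum]
    simp only [Finset.sum_const, Nat.card_Icc, add_tsub_cancel_right, nsmul_eq_mul]
    gcongr
    exact (mul_le_mul_of_nonneg_right hn hη).trans hnη
  have hD0 : 0 ≤ D := Finset.sum_nonneg fun j hj => by
    by_cases h1 : sel j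
    · exact (hsel j hj h1).symm ▸ hB.le
    · exact (hnsel j hj h1).1
  have hD1 : D ≤ B * n := by
    have : D ≤ ∑ _j ∈ Finset.Icc 1 i, B := Finset.sum_le_sum fun j hj => by
      by_cases h1 : sel j
      · exact (hsel j hj h1).le
      · exact (hnsel j hj h1).2.trans (mul_le_of_le_one_right hB.le hη1)
    refine this.trans ?_
    simp only [Finset.sum_const, Nat.card_Icc, add_tsub_cancel_right, nsmul_eq_mul]
    nlinarith
  have hBs : 0 < B * s := mul_pos hB hs
  have hden : 0 < B * s + D := by linarith
  rw [abs_sub_le_iff]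
  constructor
  · rw [sub_le_iff_le_add, div_mul_eq_mul_div, div_le_iff₀ hden]
    have h1 : N * s ≤ B * (c + δ) * s := by gcongr
    have h2 : 0 ≤ (δ + c) * D := by positivity
    linarith
  · rw [sub_le_comm, div_mul_eq_mul_div, le_div_iff₀ hden]
    by_cases hcδ : c ≤ δ
    · have h0 : 0 ≤ N * s := by
        have : 0 ≤ N := (mul_nonneg hB.le hc0).trans hN1
        positivity
      have : (c - δ) * (B * s + D) ≤ 0 := mul_nonpos_of_nonpos_of_nonneg (by linarith) hden.le
      linarith
    · have h1 : B * c * s ≤ N * s := by gcongr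
      -- The loss caused by `D` in the denominator is at most `B * n ^ 2`, which `hns` absorbs into
      -- `δ`.
      have h2 : (c - δ) * D ≤ c * (B * n) :=
        mul_le_mul (by linarith) hD1 hD0 hc0
      have h3 : c * (B * n) ≤ B * n ^ 2 := by
        have := mul_le_mul_of_nonneg_left hcn (mul_nonneg hB.le hn0)
        nlinarith
      have h4 : B * n ^ 2 ≤ B * (δ * s) := by gcongr
      linarith

/-- A head dominated by the start-of-sequence symbol, whose attention is proportional to the number
of selected positions up to a small error. -/
noncomputable def countHead (one sos : Fin d) (M : ℕ) (R : Option (Set (ℕ × ℕ))) : Head d :=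
  bilinearHead one (((M : ℝ) + (R.map fun _ => (M : ℝ)).getD 0) • Pi.single sos 1)
    (Pi.single one 1) (R.map fun S => (S, (M : ℝ)))

/-- Put `M = m + 2`. Without an RPE, SOS has weight `n ^ M` and the rest weight 1. With an RPE, the
weights of SOS, selected and unselected positions are `n ^ (2 * M)`, `n ^ M` and 1; SOS gets no
bias, so its logit is doubled by hand. The error is of order `n ^ 2 / n ^ M = n ^ (-m)`, which is at
most `2 ^ (-m)` because `n ≥ 2`. -/
theorem countHead_attend {one sos a : Fin d} {v : ℕ → Fin d → ℝ} {n i : ℕ} (hn : 2 ≤ n) (hi : i < n)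
    (m : ℕ) (R : Option (Set (ℕ × ℕ))) {A : Type u} {p : Feature A} {w : List A} (hp : ¬ p w 0)
    (hone : v i one = 1) (hsos : ∀ j ≤ i, v j sos = bit (j = 0))
    (ha : ∀ j ≤ i, v j a = bit (p w j)) :
    |(countHead one sos (m + 2) R).attend n v i a * (n : ℝ) ^ (m + 2) -
      selCount R p w i| ≤ (1 / 2) ^ m := by
  classical
  have hn0 : (0 : ℝ) < n := by positivity
  have hn2 : (2 : ℝ) ≤ n := by exact_mod_cast hn
  have hpow : Real.exp (Real.log n * ((m + 2 : ℕ) : ℝ)) = (n : ℝ) ^ (m + 2) := by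
    rw [mul_comm, Real.exp_nat_mul, Real.exp_log hn0]
  have hlog : ∀ j ≤ i, (countHead one sos (m + 2) R).logit v i j =
      (((m + 2 : ℕ) : ℝ) + (R.map fun _ => ((m + 2 : ℕ) : ℝ)).getD 0) * bit (j = 0) +
        rpeBias (R.map fun S => (S, ((m + 2 : ℕ) : ℝ))) i j := by
    intro j hj
    rw [countHead, bilinearHead_logit]
    simp only [smul_dotProduct, single_dotProduct, one_mul, hone, hsos j hj, smul_eq_mul, mul_one]
  have hδ : (n : ℝ) ^ 2 ≤ (1 / 2) ^ m * (n : ℝ) ^ (m + 2) := by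
    rw [pow_add, ← mul_assoc, ← mul_pow]
    have : 1 ≤ (1 / 2 * (n : ℝ)) ^ m := one_le_pow₀ (by linarith)
    nlinarith [sq_nonneg (n : ℝ)]
  have hM : 0 < (n : ℝ) ^ (m + 2) := by positivity
  have h1M : 1 ≤ (n : ℝ) ^ (m + 2) := one_le_pow₀ (by linarith)
  have hη : (n : ℝ) * ((n : ℝ) ^ (m + 2))⁻¹ ≤ (1 / 2) ^ m := by
    rw [← div_eq_mul_inv, div_le_iff₀ hM]
    nlinarith
  rw [Head.attend_apply, Finset.sum_congr rfl fun j hj => by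
    rw [ha j (by have := Finset.mem_range.1 hj; omega)]]
  -- `B` is the weight of a selected position: `n ^ M` with an RPE, 1 without. Here `s = n ^ M` and
  -- `η = n ^ (-M)`.
  refine abs_weighted_avg_mul_sub_card_le (sel := fun j => ∀ S ∈ R, (i, j) ∈ S)
    (p := fun j => p w j) (B := Real.exp (Real.log n * (R.map fun _ => ((m + 2 : ℕ) : ℝ)).getD 0))
    (Real.exp_pos _) hM (by positivity) (inv_le_one_of_one_le₀ h1M) (by exact_mod_cast hi.le) hη hδ
    ?_ ?_ ?_ hp
  · rw [hlog 0 (Nat.zero_le i), bit_true rfl, ← hpow, ← Real.exp_add]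
    cases R <;> simp [rpeBias, mul_add, add_comm]
  · intro j hj hsel
    have hj' := Finset.mem_Icc.1 hj
    rw [hlog j hj'.2, bit_false (by omega)]
    cases R with
    | none => simp [rpeBias]
    | some S => simp [rpeBias, hj'.1, hsel S rfl]
  · intro j hj hsel
    refine ⟨(Real.exp_pos _).le, ?_⟩
    have hj' := Finset.mem_Icc.1 hj
    rw [hlog j hj'.2, bit_false (by omega)]
    cases R with
    | none => simp at hsel
    | some S =>
      have hS : (i, j) ∉ S := by simpa using hsel
      simp only [Option.map_some, Option.getD_some, hpow]
      rw [mul_inv_cancel₀ hM.ne']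
      simp [rpeBias, hS]

/-- Uniform attention. -/
noncomputable def uniformHead (one : Fin d) : Head d := bilinearHead one 0 0 none

theorem uniformHead_attend {one sos : Fin d} {v : ℕ → Fin d → ℝ} {i : ℕ} (n : ℕ)
    (hsos : ∀ j ≤ i, v j sos = bit (j = 0)) :
    (uniformHead one).attend n v i sos = 1 / (i + 1) := by
  rw [Head.attend_apply, Finset.sum_congr rfl fun j hj => by
    rw [hsos j (by have := Finset.mem_range.1 hj; omega)]]
  simp [uniformHead, bilinearHead_logit, rpeBias, bit]

end Heads

/-! ### Layers that evaluate a threshold gate -/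

section GateLayer

variable {d : ℕ}

/-- The layer that adds `[0 < ∑ c · (output of head h in coordinate a) + b]`, the sum being over
the entries `(c, h, a)` of `H`, to coordinate `k`. -/
noncomputable def gateLayer (k : Fin d) (H : List (ℝ × Head d × Fin d)) (b : ℝ) : Layer d where
  numHeads := H.length
  heads t := (H[t]).2.1
  width := 1
  act _ := .heaviside
  W₁ := Matrix.of fun _ x => if x.2 = (H[x.1]).2.2 then (H[x.1]).1 else 0
  b₁ _ := b
  W₂ := Matrix.of fun r _ => if r = k then 1 else 0
  b₂ _ := 0

noncomputable def gateInput (n : ℕ) (v : ℕ → Fin d → ℝ) (i : ℕ) (H : List (ℝ × Head d × Fin d))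
    (b : ℝ) : ℝ :=
  (H.map fun h => h.1 * h.2.1.attend n v i h.2.2).sum + b

theorem gateLayer_apply (k : Fin d) (H : List (ℝ × Head d × Fin d)) (b : ℝ) (n : ℕ)
    (v : ℕ → Fin d → ℝ) (i : ℕ) (c : Fin d) :
    (gateLayer k H b).apply n v i c = v i c + if c = k then bit (0 < gateInput n v i H b) else 0 := by
  have hsum : ∑ x : Fin H.length × Fin d, (if x.2 = (H[x.1]).2.2 then (H[x.1]).1 else 0) *
      (H[x.1]).2.1.attend n v i x.2 = (H.map fun h => h.1 * h.2.1.attend n v i h.2.2).sum := by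
    rw [Fintype.sum_prod_type]
    have hin : ∀ t : Fin H.length, ∑ a, (if a = (H[t]).2.2 then (H[t]).1 else 0) *
        (H[t]).2.1.attend n v i a = (H[t]).1 * (H[t]).2.1.attend n v i (H[t]).2.2 := fun t => by
      rw [Finset.sum_eq_single (H[t]).2.2 (fun b _ hb => by rw [if_neg hb, zero_mul])
        (fun h => absurd (Finset.mem_univ _) h), if_pos rfl]
    rw [Finset.sum_congr rfl fun t _ => hin t]
    exact Fin.sum_univ_fun_getElem H fun h => h.1 * h.2.1.attend n v i h.2.2
  have hW : (fun t => ((gateLayer k H b).act t).eval (((gateLayer k H b).W₁.mulVec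
      (fun p => ((gateLayer k H b).heads p.1).attend n v i p.2) + (gateLayer k H b).b₁) t)) =
        fun _ => bit (0 < gateInput n v i H b) := by
    funext t
    simp only [gateInput, ← hsum, bit]
    congr
  rw [Layer.apply, Pi.add_apply, Layer.ffn, Pi.add_apply, hW]
  congr 1
  change ∑ _t : Fin 1, (if c = k then (1 : ℝ) else 0) * bit (0 < gateInput n v i H b) + 0 = _
  by_cases h : c = k <;> simp [h]

end GateLayer

/-! ### Lists of features realized by the coordinates of a transformer -/

section Realizes

variable {A : Type u} {𝓡 : Set (Set (ℕ × ℕ))}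

/-- Columns beyond the end of `G` are 0, so the residual connection lets a new gate write its value
there by addition. -/
noncomputable def columnValue (G : List (Feature A)) (w : List A) (i c : ℕ) : ℝ :=
  bit (∃ p, G[c]? = some p ∧ p w i)

/-- In every sufficiently large dimension there are an embedding and layers whose activations are
the truth values of the features in `G`. -/
structure Realizes (𝓡 : Set (Set (ℕ × ℕ))) (G : List (Feature A)) : Prop where
  one : (fun _ _ => True) ∈ G
  sos : (fun w i => tokenAt w i = none) ∈ G
  letter : ∀ a : A, (fun w i => tokenAt w i = some a) ∈ G
  exists_layers : ∀ d, G.length ≤ d → ∃ (em : Option A → Fin d → ℝ) (Ls : List (Layer d)),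
    (∀ L ∈ Ls, ∀ t R l, (L.heads t).rpe = some (R, l) → R ∈ 𝓡) ∧
    ∀ w : List A, w ≠ [] → ∀ i ≤ w.length, ∀ c : Fin d,
      Ls.foldl (fun v L => L.apply (w.length + 1) v) (fun i => em (tokenAt w i)) i c =
        columnValue G w i c

theorem exists_column {G : List (Feature A)} {p : Feature A} (hp : p ∈ G) :
    ∃ c < G.length, ∀ w i, columnValue G w i c = bit (p w i) := by
  obtain ⟨c, hc, rfl⟩ := List.mem_iff_getElem.1 hp
  exact ⟨c, hc, fun w i => by simp [columnValue, hc]⟩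

theorem tokenAt_eq_none_iff {w : List A} {i : ℕ} (hi : i ≤ w.length) :
    tokenAt w i = none ↔ i = 0 := by
  cases i with
  | zero => simp [tokenAt]
  | succ i => simpa [tokenAt] using hi

/-- The initial features depend on the token alone, so the embedding provides them with no layers.
-/
theorem exists_realizes [Finite A] (𝓡 : Set (Set (ℕ × ℕ))) :
    ∃ G : List (Feature A), Realizes 𝓡 G := by
  have := Fintype.ofFinite A
  set B : List (Option A → Prop) :=
    (fun _ => True) :: (fun t => t = none) :: Finset.univ.toList.map (fun a t => t = some a)
  refine ⟨B.map fun q w i => q (tokenAt w i), ?_, ?_, ?_, ?_⟩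
  · simp [B]
  · exact List.mem_map.2 ⟨fun t => t = none, by simp [B], rfl⟩
  · exact fun a => List.mem_map.2 ⟨fun t => t = some a,
      List.mem_cons_of_mem _ (List.mem_cons_of_mem _ (List.mem_map.2 ⟨a, by simp, rfl⟩)), rfl⟩
  · refine fun d _ => ⟨fun t c => bit (∃ q, B[(c : ℕ)]? = some q ∧ q t), [], by simp, ?_⟩
    intro w _ i _ c
    simp only [List.foldl_nil, columnValue, List.getElem?_map, Option.map_eq_some_iff]
    congr 1
    simp only [eq_iff_iff]
    constructor
    · rintro ⟨q, hq, h⟩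
      exact ⟨_, ⟨q, hq, rfl⟩, h⟩
    · rintro ⟨_, ⟨q, hq, rfl⟩, h⟩
      exact ⟨q, hq, h⟩

/-- A feature that is a threshold gate over heads reading realized features can be realized. -/
theorem Realizes.snoc {G : List (Feature A)} (hG : Realizes 𝓡 G) {p : Feature A}
    (hgate : ∀ d, G.length ≤ d → ∃ (H : List (ℝ × Head d × Fin d)) (b : ℝ),
      (∀ h ∈ H, ∀ R l, h.2.1.rpe = some (R, l) → R ∈ 𝓡) ∧
      ∀ (v : ℕ → Fin d → ℝ) (w : List A), w ≠ [] →
        (∀ j ≤ w.length, ∀ c : Fin d, v j c = columnValue G w j c) →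
        ∀ i ≤ w.length, 0 < gateInput (w.length + 1) v i H b ↔ p w i) :
    Realizes 𝓡 (G ++ [p]) := by
  refine ⟨List.mem_append_left _ hG.one, List.mem_append_left _ hG.sos,
    fun a => List.mem_append_left _ (hG.letter a), fun d hd => ?_⟩
  rw [List.length_append, List.length_singleton] at hd
  obtain ⟨em, Ls, hR, hLs⟩ := hG.exists_layers d (by omega)
  obtain ⟨H, b, hHR, hH⟩ := hgate d (by omega)
  refine ⟨em, Ls ++ [gateLayer ⟨G.length, by omega⟩ H b], ?_, ?_⟩
  · intro L hL t R l hl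
    rcases List.mem_append.1 hL with hL | hL
    · exact hR L hL t R l hl
    · obtain rfl := List.mem_singleton.1 hL
      exact hHR _ (List.getElem_mem t.2) R l hl
  · intro w hw i hi c
    rw [List.foldl_append, List.foldl_cons, List.foldl_nil, gateLayer_apply, hLs w hw i hi c,
      hH _ w hw (fun j hj c => hLs w hw j hj c) i hi]
    obtain ⟨c, hc⟩ := c
    simp only [columnValue, Fin.mk.injEq]
    rcases lt_trichotomy c G.length with h | h | h
    · rw [List.getElem?_append_left h, if_neg h.ne, add_zero]
    · subst h
      rw [List.getElem?_concat_length, if_pos rfl, bit_false (by simp), zero_add]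
      simp
    · rw [List.getElem?_eq_none h.le, List.getElem?_eq_none (by simpa using h), if_neg h.ne']
      simp [bit]

theorem Realizes.nand {G : List (Feature A)} (hG : Realizes 𝓡 G) {p q : Feature A} (hp : p ∈ G)
    (hq : q ∈ G) : Realizes 𝓡 (G ++ [fun w i => i ≠ 0 ∧ ¬(p w i ∧ q w i)]) := by
  refine hG.snoc fun d hd => ?_
  obtain ⟨o, ho, hoG⟩ := exists_column hG.one
  obtain ⟨s, hs, hsG⟩ := exists_column hG.sos
  obtain ⟨a, ha, haG⟩ := exists_column hp
  obtain ⟨b, hb, hbG⟩ := exists_column hq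
  let o' : Fin d := ⟨o, by omega⟩
  let s' : Fin d := ⟨s, by omega⟩
  let a' : Fin d := ⟨a, by omega⟩
  let b' : Fin d := ⟨b, by omega⟩
  -- With exact bits the input is at least `1 / 2` when the gate should fire and at most `-1 / 2`
  -- otherwise; the approximation errors total at most `4 / 16`. The coefficient `-2` closes the
  -- gate at SOS whatever `p` and `q` are there.
  refine ⟨[(-1, agreeHead o' a', a'), (-1, agreeHead o' b', b'), (-2, agreeHead o' s', s')], 3 / 2,
    ?_, ?_⟩
  · simp [agreeHead, bilinearHead]
  · intro v w hw hv i hi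
    have hlen : w.length ≠ 0 := by simpa using hw
    have hone : ∀ j ≤ i, v j o' = 1 := fun j hj => by
      rw [hv j (by omega), hoG, bit_true trivial]
    have key : ∀ {c : Fin d} {r : Feature A}, (∀ w i, columnValue G w i c = bit (r w i)) →
        |(agreeHead o' c).attend (w.length + 1) v i c - bit (r w i)| ≤ 1 / 16 := fun hc =>
      agreeHead_attend (p := fun j => _) (by omega) (by omega) hone fun j hj => by
        rw [hv j (by omega), hc]
    have h1 := abs_le.1 (key haG (c := a'))
    have h2 := abs_le.1 (key hbG (c := b'))
    have h3 := abs_le.1 (key hsG (c := s'))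
    rw [tokenAt_eq_none_iff hi] at h3
    simp only [gateInput, List.map_cons, List.map_nil, List.sum_cons, List.sum_nil]
    by_cases hi0 : i = 0
    · rw [bit_true hi0] at h3
      have : -(1 / 16) ≤ (agreeHead o' a').attend (w.length + 1) v i a' := by
        have : 0 ≤ bit (p w i) := by unfold bit; split_ifs <;> norm_num
        linarith
      have : -(1 / 16) ≤ (agreeHead o' b').attend (w.length + 1) v i b' := by
        have : 0 ≤ bit (q w i) := by unfold bit; split_ifs <;> norm_num
        linarith
      simp only [hi0, ne_eq, not_true_eq_false, false_and, iff_false, not_lt]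
      subst hi0
      linarith
    · rw [bit_false hi0] at h3
      by_cases hpi : p w i <;> by_cases hqi : q w i <;>
        simp only [bit_true, bit_false, hpi, hqi, not_false_eq_true] at h1 h2 <;>
        simp only [hi0, hpi, hqi, ne_eq, not_false_eq_true, and_self, and_false, false_and, not_true_eq_false,
          iff_true, iff_false, not_lt] <;> linarith

/-- Uniform attention to SOS yields `1 / (i + 1)`; subtracting the SOS bit removes position 0, after
which position 1 has the largest value. -/
theorem Realizes.first {G : List (Feature A)} (hG : Realizes 𝓡 G) :
    Realizes 𝓡 (G ++ [fun _ i => i = 1]) := by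
  refine hG.snoc fun d hd => ?_
  obtain ⟨o, ho, hoG⟩ := exists_column hG.one
  obtain ⟨s, hs, hsG⟩ := exists_column hG.sos
  let o' : Fin d := ⟨o, by omega⟩
  let s' : Fin d := ⟨s, by omega⟩
  -- `5 / 12` is midway between `1 / 2 - 1 / 16` (worst case at `i = 1`) and `1 / 3 + 1 / 16` (worst
  -- case at `i ≥ 2`).
  refine ⟨[(1, uniformHead o', s'), (-1, agreeHead o' s', s')], -(5 / 12), ?_, ?_⟩
  · simp [agreeHead, uniformHead, bilinearHead]
  · intro v w hw hv i hi
    have hlen : w.length ≠ 0 := by simpa using hw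
    have hsos : ∀ j ≤ i, v j s' = bit (j = 0) := fun j hj => by
      rw [hv j (by omega), hsG, tokenAt_eq_none_iff (by omega)]
    have h := abs_le.1 (agreeHead_attend (one := o') (n := w.length + 1) (by omega) (by omega)
      (fun j hj => by rw [hv j (by omega), hoG, bit_true trivial]) hsos)
    simp only [gateInput, List.map_cons, List.map_nil, List.sum_cons, List.sum_nil,
      uniformHead_attend (one := o') (w.length + 1) hsos]
    rcases Nat.lt_trichotomy i 1 with h1 | h1 | h1
    · obtain rfl : i = 0 := by omega
      rw [bit_true rfl] at h
      norm_num
      linarith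
    · subst h1
      rw [bit_false one_ne_zero] at h
      norm_num at h ⊢
      linarith
    · rw [bit_false (by omega)] at h
      have h2 : (2 : ℝ) ≤ i := by exact_mod_cast h1
      have h3 : 1 / ((i : ℝ) + 1) ≤ 1 / 3 := one_div_le_one_div_of_le (by norm_num) (by linarith)
      simp only [h1.ne', iff_false, not_lt]
      linarith

/-- Sums of coefficients times approximate counts are close to the corresponding integer. -/
theorem abs_linSum_approx {L : List (CountTerm A)} {w : List A} {i : ℕ} {δ s : ℝ}
    {x : CountTerm A → ℝ} (hx : ∀ t ∈ L, |x t * s - selCount t.2.1 t.2.2 w i| ≤ δ) :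
    |(L.map fun t => (t.1 : ℝ) * x t).sum * s - linSum L w i| ≤
      (L.map fun t => |(t.1 : ℝ)|).sum * δ := by
  induction L with
  | nil => simp [linSum]
  | cons t L ih =>
    have h1 := ih fun t' ht' => hx t' (List.mem_cons_of_mem _ ht')
    have h2 := mul_le_mul_of_nonneg_left (hx t List.mem_cons_self) (abs_nonneg (t.1 : ℝ))
    rw [← abs_mul] at h2
    simp only [List.map_cons, List.sum_cons, linSum_cons]
    push_cast
    calc _ = |((t.1 : ℝ) * (x t * s - selCount t.2.1 t.2.2 w i)) +
          ((L.map fun t => (t.1 : ℝ) * x t).sum * s - linSum L w i)| := by congr 1; ring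
      _ ≤ _ := (abs_add_le _ _).trans (by linarith)

theorem Realizes.pos {G : List (Feature A)} (hG : Realizes 𝓡 G) {L : List (CountTerm A)}
    (hR : ∀ t ∈ L, ∀ S ∈ t.2.1, S ∈ 𝓡) (hL : ∀ t ∈ L, t.2.2 ∈ G) (hL0 : ∀ t ∈ L, ∀ w, ¬ t.2.2 w 0)
    (hne : ∀ w i, i ≠ 0 → linSum L w i ≠ 0) :
    Realizes 𝓡 (G ++ [fun w i => 0 < linSum L w i]) := by
  refine hG.snoc fun d hd => ?_
  obtain ⟨o, ho, hoG⟩ := exists_column hG.one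
  obtain ⟨s, hs, hsG⟩ := exists_column hG.sos
  let o' : Fin d := ⟨o, by omega⟩
  let s' : Fin d := ⟨s, by omega⟩
  have hcol : ∀ t : CountTerm A, ∃ c : Fin d, t ∈ L →
      ∀ w i, columnValue G w i c = bit (t.2.2 w i) := fun t => by
    by_cases ht : t ∈ L
    · obtain ⟨c, hc, h⟩ := exists_column (hL t ht)
      exact ⟨⟨c, by omega⟩, fun _ => h⟩
    · exact ⟨o', fun h => absurd h ht⟩
  choose col hcol using hcol
  -- This `m` brings the total error, the sum of the `|c|` times `2 ^ (-m)`, below 1, uniformly in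
  -- the word.
  obtain ⟨m, hm⟩ := pow_unbounded_of_one_lt (L.map fun t => |(t.1 : ℝ)|).sum
    (one_lt_two : (1 : ℝ) < 2)
  -- All heads share one exponent, hence one scale `n ^ (m + 2)`. The threshold is 0 because a fixed
  -- bias could not follow that scale.
  refine ⟨L.map fun t => ((t.1 : ℝ), countHead o' s' (m + 2) t.2.1, col t), 0, ?_, ?_⟩
  · intro h hh R l hl
    obtain ⟨t, ht, rfl⟩ := List.mem_map.1 hh
    simp only [countHead, bilinearHead, Option.map_eq_some_iff, Prod.mk.injEq] at hl
    obtain ⟨S, hS, rfl, -⟩ := hl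
    exact hR t ht S hS
  · intro v w hw hv i hi
    have hlen : w.length ≠ 0 := by simpa using hw
    simp only [gateInput, List.map_map, Function.comp_def, add_zero]
    have hval : ∀ t ∈ L, ∀ j ≤ i, v j (col t) = bit (t.2.2 w j) := fun t ht j hj => by
      rw [hv j (by omega), hcol t ht]
    -- At position 0 the nonvanishing hypothesis is unavailable, but only SOS is attended to and the
    -- sum is exactly 0.
    by_cases hi0 : i = 0
    · subst hi0
      have : (L.map fun t => (t.1 : ℝ) *
          (countHead o' s' (m + 2) t.2.1).attend (w.length + 1) v 0 (col t)).sum = 0 := by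
        refine List.sum_eq_zero fun x hx => ?_
        obtain ⟨t, ht, rfl⟩ := List.mem_map.1 hx
        rw [Head.attend_apply]
        simp [hval t ht 0 le_rfl, bit_false (hL0 t ht w)]
      simp [this, linSum_zero]
    · have happ := abs_linSum_approx (L := L) (w := w) (i := i) (δ := (1 / 2) ^ m)
        (s := ((w.length + 1 : ℕ) : ℝ) ^ (m + 2))
        (x := fun t => (countHead o' s' (m + 2) t.2.1).attend (w.length + 1) v i (col t))
        fun t ht => countHead_attend (by omega) (by omega) m t.2.1 (hL0 t ht w)
          (by rw [hv i hi, hoG, bit_true trivial])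
          (fun j hj => by rw [hv j (by omega), hsG, tokenAt_eq_none_iff (by omega)])
          (hval t ht)
      have hlt : (L.map fun t => |(t.1 : ℝ)|).sum * (1 / 2) ^ m < 1 := by
        have h2 : (0 : ℝ) < 2 ^ m := by positivity
        rw [one_div, inv_pow, ← div_eq_mul_inv, div_lt_one h2]
        exact hm
      have hspos : (0 : ℝ) < ((w.length + 1 : ℕ) : ℝ) ^ (m + 2) := by positivity
      have h1 := abs_lt.1 (happ.trans_lt hlt)
      rw [← mul_pos_iff_of_pos_right hspos]
      constructor
      · intro h
        have h2 : ((-1 : ℤ) : ℝ) < linSum L w i := by push_cast; linarith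
        have h3 : -1 < linSum L w i := by exact_mod_cast h2
        have := hne w i hi0
        omega
      · intro h
        have h2 : ((1 : ℤ) : ℝ) ≤ linSum L w i := by exact_mod_cast h
        push_cast at h2
        linarith

theorem exists_realizes_list_mem (L : List (Feature A))
    (h : ∀ p ∈ L, ∀ G, Realizes 𝓡 G → ∃ G', Realizes 𝓡 G' ∧ G ⊆ G' ∧ p ∈ G')
    {G : List (Feature A)} (hG : Realizes 𝓡 G) : ∃ G', Realizes 𝓡 G' ∧ G ⊆ G' ∧ L ⊆ G' := by
  induction L with
  | nil => exact ⟨G, hG, List.Subset.refl _, by simp⟩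
  | cons p L ih =>
    obtain ⟨G₁, hG₁, hs₁, hm₁⟩ := ih fun q hq => h q (List.mem_cons_of_mem _ hq)
    obtain ⟨G₂, hG₂, hs₂, hm₂⟩ := h p List.mem_cons_self G₁ hG₁
    exact ⟨G₂, hG₂, List.Subset.trans hs₁ hs₂, List.cons_subset.2 ⟨hm₂, List.Subset.trans hm₁ hs₂⟩⟩

/-- Extending an arbitrary `G` keeps the subfeatures already built available when the next one is
added. -/
theorem Definable.exists_realizes_mem {p : Feature A} (hp : Definable 𝓡 p) (G : List (Feature A))
    (hG : Realizes 𝓡 G) : ∃ G', Realizes 𝓡 G' ∧ G ⊆ G' ∧ p ∈ G' := by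
  induction hp generalizing G with
  | letter a => exact ⟨G, hG, List.Subset.refl _, hG.letter a⟩
  | first => exact ⟨_, hG.first, List.subset_append_left _ _, by simp⟩
  | nand _ _ ihp ihq =>
    obtain ⟨G₁, hG₁, hs₁, hm₁⟩ := ihp G hG
    obtain ⟨G₂, hG₂, hs₂, hm₂⟩ := ihq G₁ hG₁
    exact ⟨_, hG₂.nand (hs₂ hm₁) hm₂,
      List.Subset.trans (List.Subset.trans hs₁ hs₂) (List.subset_append_left _ _), by simp⟩
  | @pos L hR hL hne ih =>
    obtain ⟨G', hG', hs, hm⟩ := exists_realizes_list_mem (L.map fun t => t.2.2) (by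
      intro p hp
      obtain ⟨t, ht, rfl⟩ := List.mem_map.1 hp
      exact ih t ht) hG
    exact ⟨_, hG'.pos hR (fun t ht => hm (List.mem_map.2 ⟨t, ht, rfl⟩))
      (fun t ht => (hL t ht).not_zero) hne, List.Subset.trans hs (List.subset_append_left _ _), by simp⟩

end Realizes

/-! ### The transformer of a program -/

/-- Appending a token keeps the current word nonempty, so nonemptiness of the state is an invariant
of the bisimulation. -/
theorem generate_congr {A : Type u} {f g : List A → Option A} (h : ∀ w, w ≠ [] → f w = g w)
    (halt : Set A) {w : List A} (hw : w ≠ []) : generate f halt w = generate g halt w := by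
  classical
  unfold generate
  refine Stream'.Seq.eq_of_bisim (fun s t => ∃ o : Option (List A), (∀ u ∈ o, u ≠ []) ∧
    s = Stream'.Seq.corec _ o ∧ t = Stream'.Seq.corec _ o) ?_
    ⟨some w, by simpa using hw, rfl, rfl⟩
  rintro _ _ ⟨o, ho, rfl, rfl⟩
  rw [Stream'.Seq.corec_eq, Stream'.Seq.corec_eq]
  cases o with
  | none => simp [Stream'.Seq.omap, Stream'.Seq.BisimO]
  | some u =>
    rw [Option.bind_some, Option.bind_some, h u (ho u rfl)]
    cases g u with
    | none => simp [Stream'.Seq.omap, Stream'.Seq.BisimO]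
    | some a =>
      refine ⟨rfl, _, ?_, rfl, rfl⟩
      split_ifs <;> simp

theorem SMAT.next_eq {A : Type u} [Finite A] (T : SMAT A) (w : List A) (o : Option A)
    (h : ∀ o', o' ≠ o →
      T.out.mulVec (T.activations w w.length) o' < T.out.mulVec (T.activations w w.length) o) :
    T.next w = o := by
  by_contra hne
  have h1 := Classical.choose_spec (Finite.exists_max (T.out.mulVec (T.activations w w.length))) o
  exact absurd h1 (not_le.2 (h _ hne))

theorem Program.exists_smat {A : Type u} [Finite A] (P : Program A) :
    ∃ T : SMAT A, T.rpes ⊆ P.rpes ∧ ∀ w, w ≠ [] → T.next w = P.next w := by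
  have := Fintype.ofFinite A
  choose p hp hpe using P.exists_definable_next
  obtain ⟨G₀, hG₀⟩ := exists_realizes (A := A) P.rpes
  obtain ⟨G, hG, -, hm⟩ := exists_realizes_list_mem (Finset.univ.toList.map p) (by
    intro q hq
    obtain ⟨a, -, rfl⟩ := List.mem_map.1 hq
    exact (hp a).exists_realizes_mem) hG₀
  obtain ⟨em, Ls, hR, hLs⟩ := hG.exists_layers G.length le_rfl
  obtain ⟨o, ho, hoG⟩ := exists_column hG.one
  choose c hc hcG using fun a => exists_column (hm (List.mem_map.2 ⟨a, by simp, rfl⟩) : p a ∈ G)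
  -- Token scores are 0 or 1, with at most one equal to 1, and EOS scores `1 / 2`. The maximum is
  -- thus strict, and the choice of argmax is forced.
  let T : SMAT A := ⟨G.length, em, Ls, fun s => match s with
    | none => Pi.single ⟨o, ho⟩ (1 / 2)
    | some a => Pi.single ⟨c a, hc a⟩ 1⟩
  have hnone : ∀ w, w ≠ [] → T.out.mulVec (T.activations w w.length) none = 1 / 2 := by
    intro w hw
    change dotProduct (Pi.single (⟨o, ho⟩ : Fin G.length) (1 / 2)) _ = _
    rw [single_dotProduct]
    have := hLs w hw w.length le_rfl ⟨o, ho⟩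
    rw [hoG, bit_true trivial] at this
    change 1 / 2 * T.activations w w.length ⟨o, ho⟩ = _
    rw [show T.activations w w.length ⟨o, ho⟩ = 1 from this, mul_one]
  have hsome : ∀ w, w ≠ [] → ∀ a, T.out.mulVec (T.activations w w.length) (some a) =
      bit (P.next w = some a) := by
    intro w hw a
    change dotProduct (Pi.single (⟨c a, hc a⟩ : Fin G.length) 1) _ = _
    rw [single_dotProduct, one_mul, ← hpe a w hw, ← hcG a w w.length]
    exact hLs w hw w.length le_rfl ⟨c a, hc a⟩
  refine ⟨T, ?_, fun w hw => T.next_eq w _ fun s hs => ?_⟩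
  · rintro R ⟨L, hL, t, l, h⟩
    exact hR L hL t R l h
  · cases hP : P.next w with
    | none =>
      rw [hP] at hs
      obtain ⟨a, rfl⟩ := Option.ne_none_iff_exists'.1 hs
      rw [hnone w hw, hsome w hw, bit_false (by simp [hP])]
      norm_num
    | some b =>
      rw [hsome w hw b, bit_true hP]
      cases s with
      | none =>
        rw [hnone w hw]
        norm_num
      | some a =>
        rw [hsome w hw, bit_false (fun h => hs h.symm)]
        norm_num

end CoTCRASP

theorem mainTheorem5 {A : Type*} [Finite A] (P : CoTCRASP.Program A) :
    ∃ T : CoTCRASP.SMAT A, T.rpes ⊆ P.rpes ∧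
      ∀ (halt : Set A) (w : List A), w ≠ [] → T.cot halt w = P.cot halt w := by
  obtain ⟨T, hT, h⟩ := P.exists_smat
  exact ⟨T, hT, fun halt _ hw => CoTCRASP.generate_congr h halt hw⟩
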